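/- **Corollary 4.3.** A *tree* is a partial order $T$ in which $t^{\downarrow}=\{s\in T: s<t\}$ is well ordered for every $t\in T$; the order type of $t^\downarrow$ is the height of $t$, the $\alpha$th level of $T$ consists of the elements of height $\alpha$, and the height of $T$ is the least ordinal greater than the heights of all its elements. A *Suslin tree* is a tree of height $\omega_1$ with countable levels and with no uncountable chains and no uncountable antichains (sets of pairwise incomparable elements). Let $S$ be a Suslin tree. A partial order $P$ is *ccc* if every set of pairwise incompatible elements of $P$ is countable, and $P$ *preserves* $S$ if every $p\in P$ forces that $\check S$ is a Suslin tree. Let $MA(S)$ be the statement: for every non-empty ccc partial order $P$ that preserves $S$ and every family $\mathcal D$ of at most $\aleph_1$ dense subsets of $P$ there is a filter $G\subseteq P$ such that $G\cap D\neq\emptyset$ for all $D\in\mathcal D$. A *ladder system on $\omega_1$* is a sequence $\mathbf C=(C_\alpha)_{\alpha\in\lim\omega_1}$, indexed by the (non-zero) countable limit ordinals, such that each $C_\alpha$ is a cofinal subset of $\alpha$ of order type $\omega$. An *$\omega$-colouring* of $\mathbf C$ is a sequence $\mathbf f=(f_\alpha)_{\alpha\in\lim\omega_1}$ of maps $f_\alpha:C_\alpha\to\omega$.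 An *$\omega_1$-uniformization* of $\mathbf f$ is a map $\varphi:\omega_1\to\omega$ such that for every $\alpha\in\lim\omega_1$, $\varphi(\xi)=f_\alpha(\xi)$ for all but finitely many $\xi\in C_\alpha$. If $S$ is a Suslin tree and $MA(S)$ holds, then every $\omega$-colouring of every ladder system on $\omega_1$ has an $\omega_1$-uniformization. -/

import Mathlib

open scoped Ordinal Cardinal

universe u v w

/-! ### Set-theoretic trees -/

/-- A (set-theoretic) tree: a partial order in which the set `Set.Iio t` of predecessors of any
element `t` is well ordered. -/
class IsSetTree (T : Type u) [PartialOrder T] : Prop where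
  isWellOrder_Iio : ∀ t : T, IsWellOrder (Set.Iio t) (· < ·)

attribute [instance] IsSetTree.isWellOrder_Iio

namespace SetTree

variable (T : Type u) [PartialOrder T] [IsSetTree T]

/-- The height of `t`: the order type of the set of its predecessors. -/
noncomputable def ht {T : Type u} [PartialOrder T] [IsSetTree T] (t : T) : Ordinal.{u} :=
  Ordinal.type (fun a b : Set.Iio t => a < b)

/-- The `α`-th level of the tree. -/
def level (α : Ordinal.{u}) : Set T := {t | ht t = α}

/-- The height of the tree: the least ordinal strictly above the heights of all its elements. -/
noncomputable def height : Ordinal.{u} := ⨆ t : T, Order.succ (ht t)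

/-- An `ℵ₁`-tree: a tree of height `ω₁` with countable levels. -/
structure IsAleph1Tree : Prop where
  height_eq : height T = ω₁
  countable_level : ∀ α < ω₁, (level T α).Countable

/-- A Suslin tree: an `ℵ₁`-tree without uncountable chains or uncountable antichains. -/
structure IsSuslin : Prop extends IsAleph1Tree T where
  countable_of_isChain : ∀ A : Set T, IsChain (· ≤ ·) A → A.Countable
  countable_of_isAntichain : ∀ A : Set T, IsAntichain (· ≤ ·) A → A.Countable

end SetTree

/-! ### Forcing

Stronger conditions are smaller. Only subsets of ground model sets have to be named in order to say
that a ground model tree is Suslin in the generic extension; for these, nice names suffice. -/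

namespace Forcing

/-- A name for a subset of the ground model set `A`: the set of pairs `(ǎ, p)` with `p ∈ X a`.
In the extension by a generic filter `G`, it denotes `{a | ∃ p ∈ G, p ∈ X a}`. -/
def Name (P : Type v) (A : Type w) : Type (max v w) := A → Set P

/-- The canonical name of a ground model set `B ⊆ A`. -/
def Name.check {P : Type v} {A : Type w} (B : Set A) : Name P A := fun a => {_p | a ∈ B}

/-- A statement of the forcing language, given by the conditions that force it. -/
def Statement (P : Type v) : Type v := P → Prop

variable {P : Type v} [PartialOrder P] {A : Type w}

namespace Statement

/-- `p` forces a statement about the ground model iff it is true. -/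
def ground (φ : Prop) : Statement P := fun _p => φ

/-- `p ⊩ ǎ ∈ X` iff the conditions below some member of `X a` are dense below `p`. -/
def mem (a : A) (X : Name P A) : Statement P :=
  fun p => ∀ q ≤ p, ∃ r ≤ q, ∃ s ∈ X a, r ≤ s

/-- `p ⊩ ¬ φ` iff no `q ≤ p` forces `φ`. -/
def neg (φ : Statement P) : Statement P := fun p => ∀ q ≤ p, ¬ φ q

/-- `p ⊩ φ ∧ ψ` iff `p` forces both. -/
def and (φ ψ : Statement P) : Statement P := fun p => φ p ∧ ψ p

/-- `p ⊩ φ → ψ` iff every `q ≤ p` that forces `φ` forces `ψ`. -/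
def imp (φ ψ : Statement P) : Statement P := fun p => ∀ q ≤ p, φ q → ψ q

/-- `p ⊩ ∀ x, φ x`, where `x` ranges over a ground model set or over the names of a given kind. -/
def all {ι : Sort*} (φ : ι → Statement P) : Statement P := fun p => ∀ x, φ x p

/-- `p ⊩ ∃ x, φ x` iff the conditions that force some instance are dense below `p`. -/
def ex {ι : Sort*} (φ : ι → Statement P) : Statement P :=
  fun p => ∀ q ≤ p, ∃ r ≤ q, ∃ x, φ x r

/-- "`X` is countable": some partial function `F` from `ℕ` to `A` covers `X`. -/
def countable (X : Name P A) : Statement P :=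
  ex fun F : Name P (ℕ × A) =>
    and
      (all fun n : ℕ => all fun a : A => all fun b : A =>
        imp (mem (n, a) F) (imp (mem (n, b) F) (ground (a = b))))
      (all fun a : A => imp (mem a X) (ex fun n : ℕ => mem (n, a) F))

/-- "`X` is a chain". -/
def isChain [PartialOrder A] (X : Name P A) : Statement P :=
  all fun a : A => all fun b : A =>
    imp (mem a X) (imp (mem b X) (ground (a ≤ b ∨ b ≤ a)))

/-- "`X` is an antichain" (of pairwise incomparable elements). -/
def isAntichain [PartialOrder A] (X : Name P A) : Statement P :=
  all fun a : A => all fun b : A =>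
    imp (mem a X) (imp (mem b X) (ground (a ≤ b → a = b)))

/-- "The ordinal `α` is the first uncountable ordinal", evaluated in the extension. -/
def isOmega1 (α : Ordinal.{u}) : Statement P :=
  and (neg (countable (Name.check (Set.Iio α))))
    (all fun β : Set.Iio α => countable (Name.check (Set.Iio (β : Ordinal.{u}))))

/-- "The ground model tree `Ť` is a Suslin tree". Being a tree, the levels and the height of the
tree are absolute; whether that height is `ω₁`, whether the levels are countable and which chains
and antichains exist is evaluated in the extension. -/
def isSuslin (P : Type v) [PartialOrder P] (T : Type u) [PartialOrder T] [IsSetTree T] :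
    Statement P :=
  and (isOmega1 (SetTree.height T))
    (and (all fun α : Set.Iio (SetTree.height T) =>
        countable (Name.check (SetTree.level T (α : Ordinal.{u}))))
      (and (all fun X : Name P T => imp (isChain X) (countable X))
        (all fun X : Name P T => imp (isAntichain X) (countable X))))

end Statement

variable (P)

/-- `P` preserves the Suslin tree `T`: every condition forces that `Ť` is a Suslin tree. -/
def PreservesSuslin (T : Type u) [PartialOrder T] [IsSetTree T] : Prop :=
  ∀ p : P, Statement.isSuslin P T p

/-- The countable chain condition: every set of pairwise incompatible conditions is countable. -/
def CCC : Prop :=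
  ∀ A : Set P, (∀ p ∈ A, ∀ q ∈ A, p ≠ q → ¬ ∃ r, r ≤ p ∧ r ≤ q) → A.Countable

variable {P}

/-- `D` is dense in `P`: every condition has an extension in `D`. -/
def IsDense (D : Set P) : Prop := ∀ p : P, ∃ q ∈ D, q ≤ p

/-- The forcing axiom `MA(S)`: for every (non-empty) ccc partial order `P` that preserves the Suslin
tree `S` and every family of at most `ℵ₁` dense subsets of `P`, some filter on `P` meets all members
of the family. -/
def MA (S : Type u) [PartialOrder S] [IsSetTree S] : Prop :=
  ∀ (P : Type u) [PartialOrder P] [Nonempty P], CCC P → PreservesSuslin P S →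
    ∀ 𝒟 : Set (Set P), #𝒟 ≤ ℵ₁ → (∀ D ∈ 𝒟, IsDense D) →
      ∃ G : Order.PFilter P, ∀ D ∈ 𝒟, ∃ p ∈ G, p ∈ D

end Forcing

/-! ### Ladder systems -/

/-- A ladder system on `ω₁`: for each countable limit ordinal `α`, a cofinal subset of `α` of order
type `ω`. (The values at other ordinals are irrelevant.) -/
structure LadderSystem where
  ladder : Ordinal.{u} → Set Ordinal.{u}
  subset_Iio : ∀ α < ω₁, Order.IsSuccLimit α → ladder α ⊆ Set.Iio α
  cofinal : ∀ α < ω₁, Order.IsSuccLimit α → ∀ β < α, ∃ ξ ∈ ladder α, β < ξ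
  orderType : ∀ α < ω₁, Order.IsSuccLimit α → Nonempty (ℕ ≃o ladder α)

namespace LadderSystem

/-- An `ω`-colouring of a ladder system: a map `f α : C α → ω` for each limit `α < ω₁`. -/
def Colouring (C : LadderSystem.{u}) : Type (u + 1) :=
  ∀ α : Ordinal.{u}, α < ω₁ → Order.IsSuccLimit α → C.ladder α → ℕ

/-- `φ : ω₁ → ω` is an `ω₁`-uniformization of `f`: for each limit `α < ω₁`, `φ` agrees with `f α`
at all but finitely many points of the ladder `C α`. -/
def IsUniformization {C : LadderSystem.{u}} (f : C.Colouring)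
    (φ : Set.Iio (ω₁ : Ordinal.{u}) → ℕ) : Prop :=
  ∀ (α : Ordinal.{u}) (hα : α < ω₁) (hlim : Order.IsSuccLimit α),
    {ξ : C.ladder α | φ ⟨ξ, (C.subset_Iio α hα hlim ξ.2).trans hα⟩ ≠ f α hα hlim ξ}.Finite

end LadderSystem

/-! ### Countable ordinals and pressing down -/

namespace Ordinal

/-! Force with finite sets of tails of the given colourings that pairwise agree as partial
functions. Distinct ladders meet in a finite set, so any condition can be extended by a sufficiently
late tail of any colouring. A filter meeting these ℵ₁ dense sets therefore glues to a
uniformization.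

To apply `MA(S)`, the poset is shown to have property K (`FiniteApprox.isKnaster`). By pressing
down, uncountably many conditions can be made to look the same below their index δ, while everything
in an earlier condition lies below the next index. Any disagreement between two of them would then
already occur inside one of them.

Property K gives ccc. It also preserves every Suslin tree (`IsKnaster.preservesSuslin`): choosing
conditions that decide membership and thinning out to compatible ones turns an uncountable chain or
antichain of the extension into one of the ground model. -/

theorem countable_Iio_of_lt_omega_one {δ : Ordinal.{u}} (hδ : δ < ω₁) :
    (Set.Iio δ).Countable := by
  rw [← Cardinal.le_aleph0_iff_set_countable, Cardinal.mk_Iio_ordinal, Cardinal.lift_le_aleph0,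
    ← Cardinal.lt_aleph_one_iff]
  rwa [← Cardinal.ord_aleph, Cardinal.lt_ord] at hδ

theorem mk_Iio_omega_one : #(Set.Iio (ω₁ : Ordinal.{u})) = ℵ₁ := by
  rw [Cardinal.mk_Iio_ordinal, ← Cardinal.ord_aleph, Cardinal.card_ord, Cardinal.lift_aleph,
    lift_one]

theorem not_countable_Iio_omega_one : ¬ (Set.Iio (ω₁ : Ordinal.{u})).Countable := by
  rw [← Cardinal.le_aleph0_iff_set_countable, mk_Iio_omega_one, not_le]
  exact Cardinal.aleph0_lt_aleph_one

theorem isSuccLimit_omega_one : Order.IsSuccLimit (ω₁ : Ordinal.{u}) :=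
  Cardinal.ord_aleph 1 ▸ Cardinal.isSuccLimit_ord (Cardinal.aleph0_le_aleph 1)

theorem exists_lt_omega_one_of_countable {s : Set Ordinal.{u}} (hs : s.Countable)
    (h : ∀ x ∈ s, x < ω₁) : ∃ δ < ω₁, ∀ x ∈ s, x < δ := by
  have := hs.to_subtype
  refine ⟨⨆ x : s, Order.succ x.1,
    iSup_lt_omega_one fun x => isSuccLimit_omega_one.succ_lt (h _ x.2), fun x hx => ?_⟩
  have hb : BddAbove (Set.range fun x : s => Order.succ x.1) :=
    ⟨ω₁, by rintro _ ⟨x, rfl⟩; exact (isSuccLimit_omega_one.succ_lt (h _ x.2)).le⟩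
  exact (Order.lt_succ x).trans_le (le_ciSup hb ⟨x, hx⟩)

/-- A function on `ω₁` has a closure point above any countable ordinal. -/
theorem exists_isSuccLimit_closed (h : Ordinal.{u} → Ordinal.{u}) (hh : ∀ γ < ω₁, h γ < ω₁)
    {δ₀ : Ordinal.{u}} (hδ₀ : δ₀ < ω₁) :
    ∃ δ < ω₁, δ₀ < δ ∧ Order.IsSuccLimit δ ∧ ∀ γ < δ, h γ < δ := by
  have key : ∀ x : Set.Iio (ω₁ : Ordinal.{u}), ∃ y : Set.Iio (ω₁ : Ordinal.{u}),
      ∀ γ ≤ x.1, γ < y.1 ∧ h γ < y.1 := by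
    rintro ⟨x, hx⟩
    have hx' := isSuccLimit_omega_one.succ_lt hx
    have hc : (Set.Iio (Order.succ x) ∪ h '' Set.Iio (Order.succ x)).Countable :=
      (countable_Iio_of_lt_omega_one hx').union ((countable_Iio_of_lt_omega_one hx').image h)
    obtain ⟨y, hy, H⟩ := exists_lt_omega_one_of_countable hc (by
      rintro z (hz | ⟨w, hw, rfl⟩)
      · exact lt_trans hz hx'
      · exact hh _ (lt_trans hw hx'))
    exact ⟨⟨y, hy⟩, fun γ hγ => ⟨H _ (Or.inl (Order.lt_succ_of_le hγ)),
      H _ (Or.inr ⟨γ, Order.lt_succ_of_le hγ, rfl⟩)⟩⟩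
  choose H hH using key
  -- Each iterate exceeds the previous one and the values of `h` up to it, so the supremum is a
  -- limit closed under `h`.
  let s : ℕ → Set.Iio (ω₁ : Ordinal.{u}) := fun n => H^[n] ⟨δ₀, hδ₀⟩
  have hs : ∀ n, s (n + 1) = H (s n) := fun n => Function.iterate_succ_apply' _ _ _
  have hb : BddAbove (Set.range fun n => (s n).1) := ⟨ω₁, by rintro _ ⟨n, rfl⟩; exact (s n).2.le⟩
  have hlt : ∀ n γ, γ ≤ (s n).1 → γ < (⨆ n, (s n).1) ∧ h γ < ⨆ n, (s n).1 := fun n γ hγ => by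
    have := hH (s n) γ hγ
    rw [← hs] at this
    exact ⟨this.1.trans_le (le_ciSup hb (n + 1)), this.2.trans_le (le_ciSup hb (n + 1))⟩
  refine ⟨⨆ n, (s n).1, iSup_lt_omega_one fun n => (s n).2, (hlt 0 δ₀ le_rfl).1, ?_, ?_⟩
  · rw [isSuccLimit_iff, Order.isSuccPrelimit_iff_succ_lt]
    refine ⟨(lt_of_le_of_lt (zero_le) (hlt 0 δ₀ le_rfl).1).ne', fun γ hγ => ?_⟩
    obtain ⟨n, hn⟩ := exists_lt_of_lt_ciSup hγ
    exact (hlt n _ (Order.succ_le_of_lt hn)).1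
  · intro γ hγ
    obtain ⟨n, hn⟩ := exists_lt_of_lt_ciSup hγ
    exact (hlt n _ hn.le).2

/-- Pressing down: a function that is regressive on a club of limits is bounded on an uncountable
subset of it. The club is given as the set of closure points of `k` above `δ₀`. -/
theorem exists_not_countable_of_regressive (k f : Ordinal.{u} → Ordinal.{u})
    (hk : ∀ γ < ω₁, k γ < ω₁) {δ₀ : Ordinal.{u}} (hδ₀ : δ₀ < ω₁)
    (hf : ∀ δ < ω₁, δ₀ < δ → Order.IsSuccLimit δ → f δ < δ) :
    ∃ γ < ω₁, ¬ {δ | δ < ω₁ ∧ δ₀ < δ ∧ Order.IsSuccLimit δ ∧ (∀ γ < δ, k γ < δ) ∧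
      f δ ≤ γ}.Countable := by
  by_contra! hcon
  have : ∀ γ, ∃ b < (ω₁ : Ordinal.{u}), γ < ω₁ → ∀ δ < ω₁, δ₀ < δ → Order.IsSuccLimit δ →
      (∀ γ < δ, k γ < δ) → f δ ≤ γ → δ < b := by
    intro γ
    by_cases hγ : γ < ω₁
    · obtain ⟨b, hb, H⟩ := exists_lt_omega_one_of_countable (hcon γ hγ) fun x hx => hx.1
      exact ⟨b, hb, fun _ δ h1 h2 h3 h4 h5 => H δ ⟨h1, h2, h3, h4, h5⟩⟩
    · exact ⟨δ₀, hδ₀, fun h => absurd h hγ⟩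
  choose b hb H using this
  -- Here `b γ` bounds the points with value at most `γ`. A point `δ` closed under `b` contradicts
  -- this for `γ = f δ < δ`.
  obtain ⟨δ, hδ, h0, hl, hc⟩ := exists_isSuccLimit_closed (fun γ => max (k γ) (b γ))
    (fun γ hγ => max_lt (hk γ hγ) (hb γ)) hδ₀
  have hfδ := hf δ hδ h0 hl
  exact lt_asymm (H (f δ) (hfδ.trans hδ) δ hδ h0 hl
    (fun γ hγ => (le_max_left _ _).trans_lt (hc γ hγ)) le_rfl)
    ((le_max_right _ _).trans_lt (hc _ hfδ))

theorem _root_.Set.Finite.exists_lt_forall_lt_of_isSuccLimit {s : Set Ordinal.{u}} (hs : s.Finite)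
    {δ : Ordinal.{u}} (hδ : Order.IsSuccLimit δ) (h : ∀ x ∈ s, x < δ) :
    ∃ b < δ, ∀ x ∈ s, x < b := by
  induction s, hs using Set.Finite.induction_on with
  | empty => exact ⟨0, hδ.bot_lt, by simp⟩
  | @insert a s _ _ ih =>
    obtain ⟨b, hb, H⟩ := ih fun x hx => h x (Set.mem_insert_of_mem _ hx)
    refine ⟨max b (Order.succ a), max_lt hb (hδ.succ_lt (h a (Set.mem_insert _ _))), ?_⟩
    rintro x (rfl | hx)
    · exact (Order.lt_succ x).trans_le (le_max_right _ _)
    · exact (H x hx).trans_le (le_max_left _ _)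

end Ordinal

theorem Set.exists_not_countable_fiber {α : Type v} {β : Type w} {A : Set α} (hA : ¬ A.Countable)
    {F : α → β} {T : Set β} (hT : T.Countable) (hF : ∀ x ∈ A, F x ∈ T) :
    ∃ t, ¬ {x ∈ A | F x = t}.Countable := by
  by_contra! h
  exact hA ((hT.biUnion fun t _ => h t).mono fun x hx => by simpa using ⟨hx, hF x hx⟩)

/-! ### Finite sets of pairwise agreeing partial functions -/

/-- Two partial functions, given by their graphs, agree on their common domain. -/
def Agree {X : Type v} (g g' : Set (X × ℕ)) : Prop :=
  ∀ ξ c c', (ξ, c) ∈ g → (ξ, c') ∈ g' → c = c'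

theorem Agree.symm {X : Type v} {g g' : Set (X × ℕ)} (h : Agree g g') : Agree g' g :=
  fun ξ c c' hc hc' => (h ξ c' c hc' hc).symm

/-- The poset of finite sets of (indices of) pairwise agreeing partial functions, ordered by
reverse inclusion. -/
def FiniteApprox {J : Type u} {X : Type v} (G : J → Set (X × ℕ)) : Type u :=
  {p : Finset J // ∀ i ∈ p, ∀ j ∈ p, Agree (G i) (G j)}

namespace FiniteApprox

variable {J : Type u} {X : Type v} {G : J → Set (X × ℕ)}

instance : PartialOrder (FiniteApprox G) where
  le p q := q.1 ⊆ p.1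
  le_refl p := Finset.Subset.refl p.1
  le_trans _ _ _ hpq hqr := Finset.Subset.trans hqr hpq
  le_antisymm _ _ hpq hqp := Subtype.ext (Finset.Subset.antisymm hqp hpq)

instance : Nonempty (FiniteApprox G) := ⟨⟨∅, by simp⟩⟩

theorem exists_le_of_agree (p q : FiniteApprox G) (h : ∀ i ∈ p.1, ∀ j ∈ q.1, Agree (G i) (G j)) :
    ∃ r, r ≤ p ∧ r ≤ q := by
  classical
  refine ⟨⟨p.1 ∪ q.1, fun i hi j hj => ?_⟩, Finset.subset_union_left, Finset.subset_union_right⟩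
  rcases Finset.mem_union.1 hi with hi | hi <;> rcases Finset.mem_union.1 hj with hj | hj
  · exact p.2 i hi j hj
  · exact h i hi j hj
  · exact (h j hj i hi).symm
  · exact q.2 i hi j hj

end FiniteApprox

namespace Forcing

/-- Property K: every `ω₁`-sequence of conditions has an uncountable subsequence of pairwise
compatible conditions. -/
def IsKnaster (P : Type u) [PartialOrder P] : Prop :=
  ∀ r : Ordinal.{u} → P, ∃ A ⊆ Set.Iio (ω₁ : Ordinal.{u}), ¬ A.Countable ∧
    ∀ x ∈ A, ∀ y ∈ A, ∃ c, c ≤ r x ∧ c ≤ r y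

end Forcing

/-- If the domain of each `G j` is a subset of `a j` whose proper initial segments are finite, then
the poset of finite approximations has property K. -/
theorem FiniteApprox.isKnaster {J : Type u} (a : J → Ordinal.{u}) (G : J → Set (Ordinal.{u} × ℕ))
    (ha : ∀ j, a j < ω₁) (hcount : ∀ γ < ω₁, {j | a j < γ}.Countable)
    (hsub : ∀ j, ∀ x ∈ G j, x.1 < a j)
    (hfin : ∀ j, ∀ δ < a j, {x ∈ G j | x.1 < δ}.Finite) :
    Forcing.IsKnaster (FiniteApprox G) := by
  intro r
  -- Infinitely many bad `δ` would include countably infinitely many below some `β < ω₁`, and the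
  -- finite condition `r β` would need an index for each.
  have hbad : {δ | δ < ω₁ ∧ ∀ ξ < ω₁, δ ≤ ξ → ∃ j ∈ (r ξ).1, a j = δ}.Finite := by
    by_contra hinf
    obtain ⟨s, hs, hsc, hsi⟩ : ∃ s ⊆ {δ | δ < ω₁ ∧ ∀ ξ < ω₁, δ ≤ ξ → ∃ j ∈ (r ξ).1, a j = δ},
        s.Countable ∧ s.Infinite := by
      refine ⟨Set.range fun n => (Set.Infinite.natEmbedding _ hinf n).1, ?_,
        Set.countable_range _, Set.infinite_range_of_injective fun m n h =>
          (Set.Infinite.natEmbedding _ hinf).injective (Subtype.ext h)⟩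
      rintro _ ⟨n, rfl⟩
      exact (Set.Infinite.natEmbedding _ hinf n).2
    obtain ⟨β, hβ, H⟩ := Ordinal.exists_lt_omega_one_of_countable hsc fun x hx => (hs hx).1
    refine hsi (((r β).1.finite_toSet.image a).subset fun x hx => ?_)
    exact (hs hx).2 β hβ (H x hx).le
  obtain ⟨δ₀, hδ₀, hδ₀'⟩ := Ordinal.exists_lt_omega_one_of_countable hbad.countable
    fun x hx => hx.1
  -- Avoiding `a j = δ` matters: such a `G j` may be infinite below `δ`, whereas those with `a j >
  -- δ` leave only a finite trace there.
  have hg : ∀ δ, ∃ ξ < (ω₁ : Ordinal.{u}), δ < ω₁ → δ₀ < δ →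
      δ ≤ ξ ∧ ∀ j ∈ (r ξ).1, a j ≠ δ := by
    intro δ
    by_cases h : δ < ω₁ ∧ δ₀ < δ
    · have : ¬ ∀ ξ < ω₁, δ ≤ ξ → ∃ j ∈ (r ξ).1, a j = δ :=
        fun H => lt_asymm h.2 (hδ₀' δ ⟨h.1, H⟩)
      push Not at this
      obtain ⟨ξ, h1, h2, h3⟩ := this
      exact ⟨ξ, h1, fun _ _ => ⟨h2, h3⟩⟩
    · exact ⟨δ₀, hδ₀, fun h1 h2 => absurd ⟨h1, h2⟩ h⟩
  choose g hg1 hg using hg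
  -- Closure under `k` will put all of `r (g δ)` below any later chosen point.
  have hk : ∀ δ, ∃ κ < (ω₁ : Ordinal.{u}), g δ < κ ∧ ∀ j ∈ (r (g δ)).1, a j < κ := by
    intro δ
    obtain ⟨κ, h1, h2⟩ := Ordinal.exists_lt_omega_one_of_countable
      (((r (g δ)).1.finite_toSet.image a).insert (g δ)).countable (by
        rintro x (rfl | ⟨j, _, rfl⟩)
        · exact hg1 δ
        · exact ha j)
    exact ⟨κ, h1, h2 _ (Set.mem_insert _ _),
      fun j hj => h2 _ (Set.mem_insert_of_mem _ ⟨j, hj, rfl⟩)⟩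
  choose k hk1 hk2 hk3 using hk
  let low : Ordinal.{u} → Set J := fun δ => {j | j ∈ (r (g δ)).1 ∧ a j < δ}
  let tr : Ordinal.{u} → Set (Ordinal.{u} × ℕ) :=
    fun δ => ⋃ j ∈ {j | j ∈ (r (g δ)).1 ∧ δ < a j}, {x ∈ G j | x.1 < δ}
  have hlow : ∀ δ, (low δ).Finite := fun δ => (r (g δ)).1.finite_toSet.subset fun j hj => hj.1
  have htr : ∀ δ, (tr δ).Finite := fun δ =>
    Set.Finite.biUnion ((r (g δ)).1.finite_toSet.subset fun j hj => hj.1)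
      fun j hj => hfin j δ hj.2
  have htr_lt : ∀ δ, ∀ x ∈ tr δ, x.1 < δ := by
    intro δ x hx
    simp only [tr, Set.mem_iUnion] at hx
    obtain ⟨j, _, hx⟩ := hx
    exact hx.2
  have hf : ∀ δ, ∃ b, δ < ω₁ → δ₀ < δ → Order.IsSuccLimit δ →
      b < δ ∧ (∀ j ∈ low δ, a j < b) ∧ ∀ x ∈ tr δ, x.1 < b := by
    intro δ
    by_cases hl : Order.IsSuccLimit δ
    · obtain ⟨b, h1, h2⟩ := (((hlow δ).image a).union
        ((htr δ).image Prod.fst)).exists_lt_forall_lt_of_isSuccLimit hl (by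
          rintro x (⟨j, hj, rfl⟩ | ⟨x, hx, rfl⟩)
          · exact hj.2
          · exact htr_lt δ x hx)
      exact ⟨b, fun _ _ _ => ⟨h1, fun j hj => h2 _ (Or.inl ⟨j, hj, rfl⟩),
        fun x hx => h2 _ (Or.inr ⟨x, hx, rfl⟩)⟩⟩
    · exact ⟨0, fun _ _ h => absurd h hl⟩
  choose f hf using hf
  obtain ⟨γ, hγ, hA⟩ := Ordinal.exists_not_countable_of_regressive k f (fun δ _ => hk1 δ) hδ₀
    fun δ h1 h2 h3 => (hf δ h1 h2 h3).1
  -- Once the bound `f δ` is at most a fixed `γ`, only countably many pairs `(low δ, tr δ)` remain,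
  -- so one pair recurs uncountably often.
  have hT : ({s : Set J | s.Finite ∧ s ⊆ {j | a j < γ}} ×ˢ
      {s : Set (Ordinal.{u} × ℕ) | s.Finite ∧ s ⊆ Set.Iio γ ×ˢ Set.univ}).Countable :=
    (Set.countable_ofPred_finite_subset (hcount γ hγ)).prod (Set.countable_ofPred_finite_subset
      ((Ordinal.countable_Iio_of_lt_omega_one hγ).prod Set.countable_univ))
  obtain ⟨⟨L, t⟩, hB⟩ := Set.exists_not_countable_fiber hA (F := fun δ => (low δ, tr δ)) hT (by
    rintro δ ⟨h1, h2, h3, -, h5⟩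
    obtain ⟨-, h6, h7⟩ := hf δ h1 h2 h3
    exact ⟨⟨hlow δ, fun j hj => (h6 j hj).trans_le h5⟩,
      ⟨htr δ, fun x hx => ⟨(h7 x hx).trans_le h5, trivial⟩⟩⟩)
  set B := {x ∈ {δ | δ < ω₁ ∧ δ₀ < δ ∧ Order.IsSuccLimit δ ∧ (∀ γ < δ, k γ < δ) ∧ f δ ≤ γ} |
    (low x, tr x) = (L, t)} with hBdef
  have hcompat : ∀ δ ∈ B, ∀ η ∈ B, δ < η → ∃ c, c ≤ r (g δ) ∧ c ≤ r (g η) := by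
    rintro δ ⟨-, hδ⟩ η ⟨⟨hη1, hη2, -, hηk, -⟩, hη⟩ hlt
    obtain ⟨hL, ht⟩ := Prod.mk.inj (hδ.trans hη.symm)
    refine FiniteApprox.exists_le_of_agree _ _ fun i hi j hj => ?_
    rcases lt_trichotomy (a j) η with hj' | hj' | hj'
    · have hjl : j ∈ low η := ⟨hj, hj'⟩
      rw [← hL] at hjl
      exact (r (g δ)).2 i hi j hjl.1
    · exact absurd hj' ((hg η hη1 hη2).2 j hj)
    -- A common point `ξ` lies below `a i < η`, hence in the trace of the later condition. The
    -- earlier one has the same trace, so one of its own members also gives `ξ` the value `c'`.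
    · intro ξ c c' hc hc'
      have hξ : ξ < η := (hsub i _ hc).trans ((hk3 δ i hi).trans (hηk δ hlt))
      have hx : (ξ, c') ∈ tr η := Set.mem_biUnion (show j ∈ {j | _ ∧ _} from ⟨hj, hj'⟩) ⟨hc', hξ⟩
      rw [← ht] at hx
      simp only [tr, Set.mem_iUnion] at hx
      obtain ⟨j', hj'', hx⟩ := hx
      exact (r (g δ)).2 i hi j' hj''.1 ξ c c' hc hx.1
  have hmono : ∀ δ ∈ B, ∀ η ∈ B, δ < η → g δ < g η := fun δ _ η hη hlt =>
    (hk2 δ).trans ((hη.1.2.2.2.1 δ hlt).trans_le (hg η hη.1.1 hη.1.2.1).1)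
  have hinj : Set.InjOn g B := by
    intro δ hδ η hη h
    by_contra hne
    rcases lt_or_gt_of_ne hne with h' | h'
    · exact (hmono δ hδ η hη h').ne h
    · exact (hmono η hη δ hδ h').ne' h
  refine ⟨g '' B, ?_, fun h => hB (Set.countable_of_injective_of_countable_image hinj h), ?_⟩
  · rintro _ ⟨δ, -, rfl⟩
    exact hg1 δ
  · rintro _ ⟨δ, hδ, rfl⟩ _ ⟨η, hη, rfl⟩
    rcases lt_trichotomy δ η with h | rfl | h
    · exact hcompat δ hδ η hη h
    · exact ⟨_, le_rfl, le_rfl⟩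
    · obtain ⟨c, h1, h2⟩ := hcompat η hη δ hδ h
      exact ⟨c, h2, h1⟩

/-! ### Property K and preservation of Suslin trees -/

namespace Forcing

open Statement

theorem Statement.mem_mono {P : Type v} [PartialOrder P] {A : Type w} {a : A} {X : Name P A}
    {p q : P} (hqp : q ≤ p) (h : mem a X p) : mem a X q :=
  fun r hr => h r (hr.trans hqp)

theorem Statement.mem_check {P : Type v} [PartialOrder P] {A : Type w} {a : A} {B : Set A}
    {p : P} : mem a (Name.check B) p ↔ a ∈ B := by
  refine ⟨fun h => ?_, fun h q _ => ⟨q, le_rfl, q, h, le_rfl⟩⟩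
  obtain ⟨_, _, _, h, _⟩ := h p le_rfl
  exact h

/-- A subset of a countable ground model set is forced to be countable. -/
theorem Statement.countable_of_forall_mem {P : Type v} [PartialOrder P] {A : Type w}
    {X : Name P A} {p : P} {B : Set A} (hB : B.Countable) (h : ∀ a, ∀ q ≤ p, mem a X q → a ∈ B) :
    countable X p := by
  obtain ⟨e, he⟩ := Set.countable_iff_exists_injOn.1 hB
  intro q hq
  -- The inverse of the ground model injection `e` serves as the enumeration.
  refine ⟨q, le_rfl, Name.check {x | x.2 ∈ B ∧ e x.2 = x.1}, ?_, ?_⟩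
  · intro n a b q₁ _ ha q₂ _ hb
    have ha := mem_check.1 ha
    have hb := mem_check.1 hb
    exact he ha.1 hb.1 (ha.2.trans hb.2.symm)
  · intro a q₁ hq₁ ha q₂ _
    exact ⟨q₂, le_rfl, e a, mem_check.2 ⟨h a q₁ (hq₁.trans hq) ha, rfl⟩⟩

namespace IsKnaster

variable {P : Type u} [PartialOrder P]

/-- Embedding `ω₁` into `B` frees property K from its indexing by ordinals. -/
theorem exists_pairwise_compatible (hP : IsKnaster P) {X : Type w} {B : Set X}
    (hB : ¬ B.Countable) (r : X → P) :
    ∃ A ⊆ B, ¬ A.Countable ∧ ∀ x ∈ A, ∀ y ∈ A, ∃ c, c ≤ r x ∧ c ≤ r y := by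
  classical
  have hcard : Cardinal.lift.{w} #(Set.Iio (ω₁ : Ordinal.{u})) ≤ Cardinal.lift.{u + 1} #B := by
    rw [Ordinal.mk_Iio_omega_one, Cardinal.lift_aleph, Ordinal.lift_one, Cardinal.aleph_one_le_iff,
      Cardinal.aleph0_lt_lift, ← not_le, Cardinal.le_aleph0_iff_set_countable]
    exact hB
  obtain ⟨e⟩ := Cardinal.lift_mk_le'.1 hcard
  obtain ⟨b, -⟩ : B.Nonempty := Set.nonempty_iff_ne_empty.2 fun h => hB (h ▸ Set.countable_empty)
  let e' : Ordinal.{u} → X := fun x => if h : x < ω₁ then (e ⟨x, h⟩).1 else b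
  have he' : ∀ x (h : x < ω₁), e' x = (e ⟨x, h⟩).1 := fun x h => dif_pos h
  obtain ⟨A, hA, hAc, H⟩ := hP fun x => r (e' x)
  refine ⟨e' '' A, ?_, fun h => hAc (Set.countable_of_injective_of_countable_image ?_ h), ?_⟩
  · rintro _ ⟨x, hx, rfl⟩
    rw [he' x (hA hx)]
    exact (e _).2
  · intro x hx y hy hxy
    rw [he' x (hA hx), he' y (hA hy)] at hxy
    exact congrArg Subtype.val (e.injective (Subtype.ext hxy))
  · rintro _ ⟨x, hx, rfl⟩ _ ⟨y, hy, rfl⟩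
    exact H x hx y hy

theorem ccc (hP : IsKnaster P) : CCC P := by
  intro A hA
  by_contra hAc
  obtain ⟨B, hBA, hB, H⟩ := hP.exists_pairwise_compatible hAc id
  refine hB (Set.Subsingleton.countable fun p hp q hq => ?_)
  by_contra hne
  exact hA p (hBA hp) q (hBA hq) hne (H p hp q hq)

/-- A property K poset forces no uncountable set to be countable. -/
theorem neg_countable_check (hP : IsKnaster P) {X : Type w} {B : Set X} (hB : ¬ B.Countable)
    (p : P) : neg (countable (Name.check B)) p := by
  intro q _ hq
  obtain ⟨r, -, F, hfun, hcov⟩ := hq q le_rfl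
  have : ∀ a, ∃ s ≤ r, a ∈ B → ∃ n, mem (n, a) F s := by
    intro a
    by_cases ha : a ∈ B
    · obtain ⟨s, hs, n, hn⟩ := hcov a r le_rfl (mem_check.2 ha) r le_rfl
      exact ⟨s, hs, fun _ => ⟨n, hn⟩⟩
    · exact ⟨r, le_rfl, fun h => absurd h ha⟩
  choose s hs h using this
  have : ∀ a, ∃ n, a ∈ B → mem (n, a) F (s a) := by
    intro a
    by_cases ha : a ∈ B
    · exact (h a ha).imp fun n hn _ => hn
    · exact ⟨0, fun h => absurd h ha⟩
  choose e he using this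
  -- Uncountably many `a` receive the same `n`; a common extension of two of their conditions would
  -- make `F` multivalued at `n`.
  obtain ⟨n, hn⟩ := Set.exists_not_countable_fiber hB (F := e) Set.countable_univ
    fun _ _ => Set.mem_univ _
  obtain ⟨A, hA, hAc, H⟩ := hP.exists_pairwise_compatible hn s
  refine hAc (Set.Subsingleton.countable fun a ha b hb => ?_)
  obtain ⟨c, hca, hcb⟩ := H a ha b hb
  have hma := mem_mono hca (he a (hA ha).1)
  have hmb := mem_mono hcb (he b (hA hb).1)
  rw [(hA ha).2] at hma
  rw [(hA hb).2] at hmb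
  exact hfun n a b c (hca.trans (hs a)) hma c le_rfl hmb

/-- If every ground model set whose elements are pairwise in the relation `R` is countable, then
this remains true in the extension by a property K poset. -/
theorem countable_of_pairwise (hP : IsKnaster P) {X : Type w} {R : X → X → Prop}
    (hR : ∀ A : Set X, (∀ a ∈ A, ∀ b ∈ A, R a b) → A.Countable) {Y : Name P X} {p : P}
    (hY : ∀ a b, imp (mem a Y) (imp (mem b Y) (ground (R a b))) p) : countable Y p := by
  -- For each possible element of `Y`, fix a condition forcing it in. Compatibility of two of these
  -- makes `R` hold outright, as `R` is a ground model relation.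
  have : ∀ a, ∃ q ≤ p, (∃ q ≤ p, mem a Y q) → mem a Y q := by
    intro a
    by_cases h : ∃ q ≤ p, mem a Y q
    · obtain ⟨q, hq, hm⟩ := h
      exact ⟨q, hq, fun _ => hm⟩
    · exact ⟨p, le_rfl, fun h' => absurd h' h⟩
  choose r hr hmem using this
  refine countable_of_forall_mem (B := {a | ∃ q ≤ p, mem a Y q}) ?_ fun a q hq hm => ⟨q, hq, hm⟩
  by_contra hB
  obtain ⟨A, hA, hAc, H⟩ := hP.exists_pairwise_compatible hB r
  refine hAc (hR A fun a ha b hb => ?_)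
  obtain ⟨c, hca, hcb⟩ := H a ha b hb
  exact hY a b c (hca.trans (hr a)) (mem_mono hca (hmem a (hA ha))) c le_rfl
    (mem_mono hcb (hmem b (hA hb)))

theorem preservesSuslin (hP : IsKnaster P) {T : Type w} [PartialOrder T] [IsSetTree T]
    (hT : SetTree.IsSuslin T) : PreservesSuslin P T := by
  intro p
  have hcheck : ∀ {X : Type (w + 1)} {B : Set X}, B.Countable → countable (Name.check B) p :=
    fun hB => countable_of_forall_mem hB fun _ _ _ => mem_check.1
  refine ⟨⟨?_, fun β => ?_⟩, fun α => ?_, fun X q _ hX => ?_, fun X q _ hX => ?_⟩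
  · rw [hT.height_eq]
    exact hP.neg_countable_check Ordinal.not_countable_Iio_omega_one p
  · refine hcheck (Ordinal.countable_Iio_of_lt_omega_one ?_)
    exact hT.height_eq ▸ β.2
  · refine countable_of_forall_mem (hT.countable_level α ?_) fun _ _ _ => mem_check.1
    exact hT.height_eq ▸ α.2
  · exact hP.countable_of_pairwise (R := fun a b => a ≤ b ∨ b ≤ a)
      (fun A hA => hT.countable_of_isChain A fun a ha b hb _ => hA a ha b hb) hX
  · exact hP.countable_of_pairwise (R := fun a b => a ≤ b → a = b)
      (fun A hA => hT.countable_of_isAntichain A fun a ha b hb hne hab => hne (hA a ha b hb hab)) hX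

end IsKnaster

end Forcing

/-! ### Uniformization -/

/-- Under `MA(S)`, colourings of ladders that are given by their enumerations can be
uniformized. -/
theorem Forcing.MA.exists_uniformization {S : Type u} [PartialOrder S] [IsSetTree S]
    (hS : SetTree.IsSuslin S) (hMA : Forcing.MA S) {I : Type u} (a : I → Ordinal.{u})
    (ha : Function.Injective a) (hlt : ∀ i, a i < ω₁) (e : I → ℕ → Ordinal.{u})
    (he : ∀ i, StrictMono (e i)) (hea : ∀ i n, e i n < a i)
    (hcof : ∀ i, ∀ δ < a i, ∃ n, δ < e i n) (c : I → ℕ → ℕ) :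
    ∃ φ : Ordinal.{u} → ℕ, ∀ i, ∃ N, ∀ n ≥ N, φ (e i n) = c i n := by
  classical
  let G : I × ℕ → Set (Ordinal.{u} × ℕ) :=
    fun j => (fun n => (e j.1 n, c j.1 n)) '' Set.Ici j.2
  have hfin : ∀ j : I × ℕ, ∀ δ < a j.1, {x ∈ G j | x.1 < δ}.Finite := by
    rintro ⟨i, m⟩ δ hδ
    obtain ⟨n, hn⟩ := hcof i δ hδ
    refine ((Set.finite_Iio n).image fun n => (e i n, c i n)).subset ?_
    rintro _ ⟨⟨k, -, rfl⟩, hk⟩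
    exact ⟨k, (he i).lt_iff_lt.1 (lt_trans hk hn), rfl⟩
  have hsub : ∀ j : I × ℕ, ∀ x ∈ G j, x.1 < a j.1 := by
    rintro ⟨i, m⟩ _ ⟨k, -, rfl⟩
    exact hea i k
  have hK : Forcing.IsKnaster (FiniteApprox G) := by
    refine FiniteApprox.isKnaster (fun j => a j.1) G (fun j => hlt j.1) (fun γ hγ => ?_) hsub hfin
    exact (((Ordinal.countable_Iio_of_lt_omega_one hγ).preimage ha).prod
      (Set.countable_univ (α := ℕ))).mono fun j (hj : a j.1 < γ) => Set.mk_mem_prod hj (Set.mem_univ _)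
  -- On one ladder, the enumeration is injective. On two, the points shared with the higher ladder
  -- are bounded below the lower limit, so the intersection is finite.
  have hagree : ∀ i (j : I × ℕ), ∃ N, ∀ n ≥ N, Agree (G (i, n)) (G j) := by
    rintro i ⟨i', m⟩
    rcases eq_or_ne i i' with rfl | hne
    · refine ⟨0, fun n _ => ?_⟩
      rintro ξ _ _ ⟨k, -, hk⟩ ⟨k', -, hk'⟩
      obtain ⟨h1, rfl⟩ := Prod.mk.inj hk
      obtain ⟨h2, rfl⟩ := Prod.mk.inj hk'
      rw [(he i).injective (h1.trans h2.symm)]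
    · have hF : {k | ∃ k', e i k = e i' k'}.Finite := by
        rcases lt_or_gt_of_ne (ha.ne hne) with h | h
        · refine Set.Finite.of_finite_image (f := e i) (((hfin (i', 0) _ h).image Prod.fst).subset
            ?_) (he i).injective.injOn
          rintro _ ⟨k, ⟨k', hk⟩, rfl⟩
          exact ⟨_, ⟨⟨k', Nat.zero_le _, rfl⟩, (hk ▸ hea i k : e i' k' < a i)⟩, hk.symm⟩
        · obtain ⟨n, hn⟩ := hcof i _ h
          refine (Set.finite_Iio n).subset ?_
          rintro k ⟨k', hk⟩
          exact (he i).lt_iff_lt.1 ((hk ▸ hea i' k').trans hn)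
      obtain ⟨N, hN⟩ := hF.bddAbove
      refine ⟨N + 1, fun n hn => ?_⟩
      rintro ξ _ _ ⟨k, hkn, hk⟩ ⟨k', -, hk'⟩
      have := hN ⟨k', (Prod.mk.inj hk).1.trans (Prod.mk.inj hk').1.symm⟩
      have : n ≤ k := hkn
      omega
  let D : I → Set (FiniteApprox G) := fun i => {p | ∃ n, (i, n) ∈ p.1}
  have hD : ∀ i, Forcing.IsDense (D i) := by
    intro i p
    choose N hN using hagree i
    have hself : Agree (G (i, p.1.sup N)) (G (i, p.1.sup N)) := by
      rintro ξ _ _ ⟨k, -, hk⟩ ⟨k', -, hk'⟩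
      obtain ⟨h1, rfl⟩ := Prod.mk.inj hk
      obtain ⟨h2, rfl⟩ := Prod.mk.inj hk'
      rw [(he i).injective (h1.trans h2.symm)]
    obtain ⟨q, hq1, hq2⟩ := FiniteApprox.exists_le_of_agree (G := G) ⟨{(i, p.1.sup N)}, by
      simpa using hself⟩ p (by
        intro j hj j' hj'
        rw [Finset.mem_singleton.1 hj]
        exact hN j' _ (Finset.le_sup hj'))
    exact ⟨q, ⟨_, hq1 (Finset.mem_singleton_self _)⟩, hq2⟩
  have hcard : #(Set.range D) ≤ ℵ₁ := by
    refine Cardinal.mk_range_le.trans ?_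
    have := Cardinal.lift_mk_le'.2 (⟨fun i => (⟨a i, hlt i⟩ : Set.Iio (ω₁ : Ordinal.{u})),
      fun i j h => ha (congrArg Subtype.val h)⟩ : Nonempty (I ↪ Set.Iio (ω₁ : Ordinal.{u})))
    rw [Ordinal.mk_Iio_omega_one] at this
    simpa using this
  obtain ⟨F, hF⟩ := hMA (FiniteApprox G) hK.ccc (hK.preservesSuslin hS) (Set.range D) hcard
    (Set.forall_mem_range.2 hD)
  -- The value is well defined since any two conditions of the filter have a common extension; 0 is
  -- used off the union of the domains.
  let φ : Ordinal.{u} → ℕ := fun ξ =>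
    if h : ∃ y, ∃ p ∈ F, ∃ j ∈ p.1, (ξ, y) ∈ G j then h.choose else 0
  refine ⟨φ, fun i => ?_⟩
  obtain ⟨p, hpF, N, hN⟩ := hF _ ⟨i, rfl⟩
  refine ⟨N, fun n hn => ?_⟩
  have hmem : (e i n, c i n) ∈ G (i, N) := ⟨n, hn, rfl⟩
  have hex : ∃ y, ∃ p ∈ F, ∃ j ∈ p.1, (e i n, y) ∈ G j := ⟨_, p, hpF, _, hN, hmem⟩
  have hφ : φ (e i n) = hex.choose := dif_pos hex
  obtain ⟨q, hqF, j, hj, hjm⟩ := hex.choose_spec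
  obtain ⟨r, -, hrp, hrq⟩ := F.directed p hpF q hqF
  rw [hφ]
  exact r.2 j (hrq hj) (i, N) (hrp hN) _ _ _ hjm hmem

theorem corollary4p3 (S : Type u) [PartialOrder S] [IsSetTree S]
    (hS : SetTree.IsSuslin S) (hMA : Forcing.MA S)
    (C : LadderSystem.{u}) (f : C.Colouring) :
    ∃ φ : Set.Iio (ω₁ : Ordinal.{u}) → ℕ, LadderSystem.IsUniformization f φ := by
  let L : Set Ordinal.{u} := {α | α < ω₁ ∧ Order.IsSuccLimit α}
  -- `MA(S)` quantifies over posets in `Type u`, so the limit ordinals must be reindexed by a type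
  -- in that universe.
  have : Small.{u} L := small_subset (t := L) (s := Set.Iio ω₁) fun α (h : α ∈ L) => h.1
  let s : Shrink.{u} L ≃ L := (equivShrink L).symm
  let o : ∀ α : L, ℕ ≃o C.ladder α := fun α => (C.orderType α α.2.1 α.2.2).some
  obtain ⟨φ, hφ⟩ := Forcing.MA.exists_uniformization hS hMA (fun i => (s i : Ordinal.{u}))
    (Subtype.val_injective.comp s.injective) (fun i => (s i).2.1) (fun i n => o (s i) n)
    (fun i => (o (s i)).strictMono)
    (fun i n => C.subset_Iio _ (s i).2.1 (s i).2.2 (o (s i) n).2)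
    (fun i δ hδ => by
      obtain ⟨ξ, hξ, h⟩ := C.cofinal _ (s i).2.1 (s i).2.2 δ hδ
      exact ⟨(o (s i)).symm ⟨ξ, hξ⟩, by simpa using h⟩)
    (fun i n => f _ (s i).2.1 (s i).2.2 (o (s i) n))
  refine ⟨fun ξ => φ ξ, fun α hα hlim => ?_⟩
  obtain ⟨N, hN⟩ := hφ (s.symm ⟨α, hα, hlim⟩)
  rw [s.apply_symm_apply] at hN
  refine ((Set.finite_Iio N).image (o ⟨α, hα, hlim⟩)).subset fun ξ hξ => ?_
  refine ⟨(o ⟨α, hα, hlim⟩).symm ξ, ?_, by simp⟩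
  by_contra hle
  exact hξ (by simpa using hN _ (not_lt.1 hle))
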